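/- All digraphs are finite, without loops or parallel arcs. A tournament is a digraph in which each pair of distinct vertices is joined by precisely one arc. A digraph $D$ is strong if for all vertices $u,v$ there is a directed path from $u$ to $v$, and $m$-strong if it has at least $m+1$ vertices and $D-S$ is strong for every set $S$ of fewer than $m$ vertices. A digraph $D$ is $k^{*}$-strongly connected if for any two distinct vertices $u,v$ there is a set of $k$ pairwise distinct, internally disjoint directed paths which together contain all vertices of $D$ and which have the same direction between $u$ and $v$, i.e. either all $k$ of them are $(u,v)$-paths or all $k$ of them are $(v,u)$-paths. Theorem. For every integer $k\ge 2$, every $2k$-strong tournament is $k^{*}$-strongly connected. -/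

import Mathlib

namespace Digraph

/-- A tournament: there are no loops, and any two distinct vertices are joined by precisely
one arc. -/
def IsTournament {V : Type*} (G : Digraph V) : Prop :=
  (∀ v, ¬ G.Adj v v) ∧ ∀ u v, u ≠ v → Xor (G.Adj u v) (G.Adj v u)

/-- The digraph obtained from `G` by deleting the vertices in `S`. -/
def deleteVertices {V : Type*} (G : Digraph V) (S : Finset V) : Digraph {v : V // v ∉ S} where
  Adj u v := G.Adj u v

/-- A digraph is strong if every vertex is reachable from every vertex along arcs. -/
def IsStrong {V : Type*} (G : Digraph V) : Prop :=
  ∀ u v, Relation.ReflTransGen G.Adj u v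

/-- A finite digraph is `k`-strong if it has at least `k + 1` vertices and remains strong
after deleting any set of fewer than `k` vertices. -/
def IsKStrong {V : Type*} [Fintype V] (G : Digraph V) (k : ℕ) : Prop :=
  k + 1 ≤ Fintype.card V ∧ ∀ S : Finset V, S.card < k → (G.deleteVertices S).IsStrong

/-- `G.IsPathFromTo u v p`: the list `p` is the vertex sequence of a (directed) `(u, v)`-path
of `G`; its vertices are pairwise distinct and each one dominates the next. -/
def IsPathFromTo {V : Type*} (G : Digraph V) (u v : V) (p : List V) : Prop :=
  p.IsChain G.Adj ∧ p.Nodup ∧ p.head? = some u ∧ p.getLast? = some v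

/-- `C` is a set of `k` (distinct) internally disjoint `(u, v)`-paths of `G` that together
contain all the vertices of `G`. -/
def IsSpanningContainerFromTo {V : Type*} (G : Digraph V) (k : ℕ) (u v : V)
    (C : Finset (List V)) : Prop :=
  C.card = k ∧
  (∀ p ∈ C, G.IsPathFromTo u v p) ∧
  (∀ p ∈ C, ∀ q ∈ C, p ≠ q → ∀ w, w ∈ p → w ∈ q → w = u ∨ w = v) ∧
  (∀ w, ∃ p ∈ C, w ∈ p)

/-- `C` is a strong `k*`-container between `u` and `v`: its `k` paths either all go from
`u` to `v` or all go from `v` to `u`. -/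
def IsStrongStarContainer {V : Type*} (G : Digraph V) (k : ℕ) (u v : V)
    (C : Finset (List V)) : Prop :=
  G.IsSpanningContainerFromTo k u v C ∨ G.IsSpanningContainerFromTo k v u C

/-- `G` is `k*`-strongly connected: there is a strong `k*`-container between any two
distinct vertices. -/
def IsStarStronglyConnected {V : Type*} (G : Digraph V) (k : ℕ) : Prop :=
  ∀ u v, u ≠ v → ∃ C : Finset (List V), G.IsStrongStarContainer k u v C

end Digraph

namespace Digraph

variable {V : Type*}

/-! Orient the problem so that `u` does not dominate `v`; every `(u, v)`-path then has an internal
vertex. Menger's theorem (`exists_isPathSystem`) gives `n = 2k` internally disjoint `(u, v)`-paths;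
take such a family covering as many vertices as possible, and let `R` be the set of missed vertices.

By maximality no `r ∈ R` can be inserted into a path, so on each path the vertices dominating `r`
form a final segment. Hence `r` dominates the first internal vertex of the path or is dominated by
the last one. Strong connectivity then lets `exists_path_covering` produce a Hamiltonian path `s` of
`R` that can be entered from the end of some path `p` and left to the start of some path `q`. If `p
≠ q`, then `p, s, q` is a single path replacing two; if `p = q`, cutting `s` in two and using two
further paths makes one path out of three.

So at least `n - 2 ≥ k` paths cover everything. In a tournament two disjoint paths with common ends
interleave into one (`exists_merge`), which brings the number down to exactly `k`. -/

/-- A family of internally disjoint `(u, v)`-paths, each given by the list of its internal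
vertices. -/
def IsPathSystem (G : Digraph V) (u v : V) (L : List (List V)) : Prop :=
  (∀ p ∈ L, (u :: (p ++ [v])).IsChain G.Adj) ∧ (u :: v :: L.flatten).Nodup

/-! ### Menger's theorem by way of Hall's theorem -/

/-- Strong connectivity gives an arc leaving every set that separates two vertices. -/
theorem IsStrong.exists_adj_leaving {G : Digraph V} {S : Finset V}
    (h : (G.deleteVertices S).IsStrong) (Z : Set V) {a b : V} (ha : a ∉ S) (hb : b ∉ S)
    (haZ : a ∈ Z) (hbZ : b ∉ Z) : ∃ z ∈ Z, ∃ w, w ∉ Z ∧ z ∉ S ∧ w ∉ S ∧ G.Adj z w := by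
  by_contra! hc
  refine hbZ ?_
  have key : ∀ y : {x : V // x ∉ S},
      Relation.ReflTransGen (G.deleteVertices S).Adj ⟨a, ha⟩ y → (y : V) ∈ Z := by
    intro y hy
    induction hy with
    | refl => exact haZ
    | @tail y z _ hyz ih =>
      by_contra hz
      exact hc y ih z hz y.2 z.2 hyz
  exact key ⟨b, hb⟩ (h _ _)

/-- The vertex-disjoint path version of Hall's condition: a successor function on the vertices
together with `n` copies of the source, into the vertices together with `n` copies of the sink. -/
theorem exists_successor_function [Fintype V] (G : Digraph V) {u v : V} (huv : u ≠ v)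
    (hadj : ¬ G.Adj u v) {n : ℕ}
    (hs : ∀ S : Finset V, S.card < n → (G.deleteVertices S).IsStrong) :
    ∃ f : V ⊕ Fin n → V ⊕ Fin n, Function.Injective f ∧
      (∀ i j, f (Sum.inr i) ≠ Sum.inr j) ∧
      (∀ i y, f (Sum.inr i) = Sum.inl y → y ≠ u ∧ y ≠ v ∧ G.Adj u y) ∧
      (∀ x y, f (Sum.inl x) = Sum.inl y → y = x ∨ (y ≠ u ∧ y ≠ v ∧ G.Adj x y)) ∧
      (∀ x j, f (Sum.inl x) = Sum.inr j → G.Adj x v) := by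
  classical
  -- The copies `Sum.inr` are sources on the left and sinks on the right. Relating each vertex to
  -- itself lets vertices on no path be fixed points.
  let r : V ⊕ Fin n → V ⊕ Fin n → Prop := fun a b =>
    Sum.elim
      (fun x => Sum.elim
        (fun y => y = x ∨ (x ≠ u ∧ x ≠ v ∧ y ≠ u ∧ y ≠ v ∧ G.Adj x y))
        (fun _ => x ≠ u ∧ x ≠ v ∧ G.Adj x v) b)
      (fun _ => Sum.elim (fun y => y ≠ u ∧ y ≠ v ∧ G.Adj u y) (fun _ => False) b) a
  let t : V ⊕ Fin n → Finset (V ⊕ Fin n) := fun a => Finset.univ.filter (r a)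
  have hall : ∀ S : Finset (V ⊕ Fin n), S.card ≤ (S.biUnion t).card := by
    intro S
    have memN : ∀ b, b ∈ S.biUnion t ↔ ∃ a ∈ S, r a b := by
      intro b; simp [t]
    generalize hN : S.biUnion t = N at memN ⊢
    have hsub : S.toLeft ⊆ N.toLeft := by
      intro x hx
      rw [Finset.mem_toLeft] at hx ⊢
      exact (memN _).2 ⟨_, hx, Or.inl rfl⟩
    have cS := S.card_toLeft_add_card_toRight
    have cN := N.card_toLeft_add_card_toRight
    have hle := Finset.card_le_card hsub
    have hSn : S.toRight.card ≤ n := by simpa using Finset.card_le_univ S.toRight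
    by_contra hlt
    have hpos : 0 < S.toRight.card := by omega
    obtain ⟨i, hi⟩ := Finset.card_pos.1 hpos
    rw [Finset.mem_toRight] at hi
    have hno : ∀ x, Sum.inl x ∈ S → x ≠ u → x ≠ v → ¬ G.Adj x v := by
      intro x hx hxu hxv hadjx
      have : N.toRight = Finset.univ := by
        ext j
        simp only [Finset.mem_toRight, Finset.mem_univ, iff_true]
        exact (memN _).2 ⟨_, hx, hxu, hxv, hadjx⟩
      rw [this, Finset.card_univ, Fintype.card_fin] at cN
      omega
    -- A violation of Hall's condition yields a separator: the new neighbours of `S` number fewer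
    -- than `n`, and deleting them leaves no way from `u` to `v`.
    have hX : (N.toLeft \ S.toLeft).card < n := by
      rw [Finset.card_sdiff_of_subset hsub]; omega
    have hux : u ∉ N.toLeft \ S.toLeft := by
      simp only [Finset.mem_sdiff, Finset.mem_toLeft, memN, not_and, not_not]
      rintro ⟨a | a, ha, hr⟩
      · rcases hr with h | h
        · exact h ▸ ha
        · exact absurd rfl h.2.2.1
      · exact absurd rfl hr.1
    have hvx : v ∉ N.toLeft \ S.toLeft := by
      simp only [Finset.mem_sdiff, Finset.mem_toLeft, memN, not_and, not_not]
      rintro ⟨a | a, ha, hr⟩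
      · rcases hr with h | h
        · exact h ▸ ha
        · exact absurd rfl h.2.2.2.1
      · exact absurd rfl hr.2.1
    obtain ⟨z, hz, w, hw, -, hwX, hzw⟩ := (hs _ hX).exists_adj_leaving
      {x | x = u ∨ (x ≠ v ∧ Sum.inl x ∈ S)} hux hvx (Or.inl rfl)
      (by rintro (h | h); exacts [huv h.symm, h.1 rfl])
    simp only [Set.mem_ofPred_eq, not_or, not_and] at hz hw
    obtain ⟨hwu, hw⟩ := hw
    by_cases hwv : w = v
    · subst hwv
      by_cases hzu : z = u
      · exact hadj (hzu ▸ hzw)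
      · obtain ⟨h1, h2⟩ := hz.resolve_left hzu
        exact hno z h2 hzu h1 hzw
    · refine hwX (Finset.mem_sdiff.2 ⟨?_, fun h => hw hwv (Finset.mem_toLeft.1 h)⟩)
      rw [Finset.mem_toLeft, memN]
      by_cases hzu : z = u
      · exact ⟨_, hi, hwu, hwv, hzu ▸ hzw⟩
      · obtain ⟨h1, h2⟩ := hz.resolve_left hzu
        exact ⟨_, h2, Or.inr ⟨hzu, h1, hwu, hwv, hzw⟩⟩
  obtain ⟨f, hf, hft⟩ := (Finset.all_card_le_biUnion_card_iff_exists_injective t).1 hall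
  have hr : ∀ a, r a (f a) := fun a => (Finset.mem_filter.1 (hft a)).2
  refine ⟨f, hf, fun i j h => ?_, fun i y h => ?_, fun x y h => ?_, fun x j h => ?_⟩
  · have := hr (Sum.inr i); rw [h] at this; exact this
  · have := hr (Sum.inr i); rw [h] at this; exact this
  · have := hr (Sum.inl x); rw [h] at this
    exact this.imp id fun h => h.2.2
  · have := hr (Sum.inl x); rw [h] at this; exact this.2.2

/-- Menger's theorem for two vertices not joined by an arc. -/
theorem exists_isPathSystem [Fintype V] (G : Digraph V) {u v : V} (huv : u ≠ v)
    (hadj : ¬ G.Adj u v) {n : ℕ}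
    (hs : ∀ S : Finset V, S.card < n → (G.deleteVertices S).IsStrong) :
    ∃ L : List (List V), L.length = n ∧ G.IsPathSystem u v L := by
  classical
  obtain ⟨f, hf, hrr, hrl, hll, hlr⟩ := exists_successor_function G huv hadj hs
  -- With sinks identified with sources, `f` is a permutation of a finite set, so the orbit of a
  -- source returns to a copy; its vertices before the first return are the interior of a path.
  have hex : ∀ i : Fin n, ∃ k j, f^[k + 1] (Sum.inr i) = Sum.inr j := by
    intro i
    have := Function.minimalPeriod_pos_of_mem_periodicPts (hf.mem_periodicPts (Sum.inr i))
    refine ⟨Function.minimalPeriod f (Sum.inr i) - 1, i, ?_⟩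
    rw [Nat.sub_add_cancel this]
    exact Function.iterate_minimalPeriod
  let k : Fin n → ℕ := fun i => Nat.find (hex i)
  have hk : ∀ i, ∃ j, f^[k i + 1] (Sum.inr i) = Sum.inr j := fun i => Nat.find_spec (hex i)
  have hlt : ∀ i a, a < k i → ∃ y, f^[a + 1] (Sum.inr i) = Sum.inl y := by
    intro i a ha
    have := Nat.find_min (hex i) ha
    rcases h : f^[a + 1] (Sum.inr i) with y | j
    · exact ⟨y, rfl⟩
    · exact absurd ⟨j, h⟩ this
  let h : Fin n → ℕ → V := fun i a =>
    Sum.elim id (fun _ => if a = 0 then u else v) (f^[a] (Sum.inr i))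
  have hl : ∀ i a, a < k i → f^[a + 1] (Sum.inr i) = Sum.inl (h i (a + 1)) := by
    intro i a ha
    obtain ⟨y, hy⟩ := hlt i a ha
    simp only [h, hy, Sum.elim_inl, id]
  have h0 : ∀ i, h i 0 = u := fun i => by simp [h]
  have hend : ∀ i, h i (k i + 1) = v := by
    intro i
    obtain ⟨j, hj⟩ := hk i
    simp [h, hj]
  have hfix : ∀ i a, f^[a + 1] (Sum.inr i) ≠ f^[a] (Sum.inr i) := by
    intro i a he
    rw [Function.iterate_succ_apply] at he
    exact hrr i i (hf.iterate a he)
  have hstep : ∀ i a, f^[a + 1] (Sum.inr i) = f (f^[a] (Sum.inr i)) := fun i a =>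
    Function.iterate_succ_apply' f a _
  have hinner : ∀ i a, a < k i → h i (a + 1) ≠ u ∧ h i (a + 1) ≠ v ∧
      G.Adj (h i a) (h i (a + 1)) := by
    intro i a ha
    have e := hl i a ha
    rw [hstep] at e
    rcases a with _ | a
    · rw [h0]
      exact hrl i _ e
    · have e' := hl i a (by omega)
      rw [e'] at e
      refine (hll _ _ e).resolve_left fun hh => hfix i (a + 1) ?_
      rw [hl i _ ha, hh, ← e']
  refine ⟨(List.finRange n).map fun i => (List.range (k i)).map fun a => h i (a + 1), by simp,
    ?_, ?_⟩
  · intro p hp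
    obtain ⟨i, -, rfl⟩ := List.mem_map.1 hp
    have : u :: (((List.range (k i)).map fun a => h i (a + 1)) ++ [v]) =
        (List.range (k i + 1 + 1)).map (h i) := by
      rw [List.range_succ_eq_map, List.range_succ]
      simp [h0, hend, Function.comp_def]
    rw [this, List.isChain_map, List.isChain_range]
    intro a ha
    rcases (show a ≤ k i by omega).lt_or_eq with ha | rfl
    · exact (hinner i a ha).2.2
    · obtain ⟨j, hj⟩ := hk i
      rw [Nat.succ_eq_add_one, hend]
      rw [hstep] at hj
      generalize hki : k i = m at hj ⊢
      rcases m with _ | m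
      · exact absurd hj (hrr i j)
      · rw [hl i m (by omega)] at hj
        exact hlr _ _ hj
  · have hinj : ∀ i j a b, a < k i → b < k j → a ≤ b → h i (a + 1) = h j (b + 1) →
        a = b ∧ i = j := by
      intro i j a b ha hb hab he
      have e : f^[a + 1] (Sum.inr i) = f^[b + 1] (Sum.inr j) := by
        rw [hl i a ha, hl j b hb, he]
      obtain ⟨c, rfl⟩ := Nat.exists_eq_add_of_le hab
      rw [show a + c + 1 = (a + 1) + c by ring, Function.iterate_add_apply f (a + 1) c] at e
      -- Cancelling the common iterates moves the coincidence back to source `i`, which cannot be an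
      -- internal vertex of orbit `j`.
      have e := hf.iterate _ e
      rcases c with _ | c
      · exact ⟨rfl, by simpa using e⟩
      · rw [hl j c (by omega)] at e
        cases e
    have hinj' : ∀ i j a b, a < k i → b < k j → h i (a + 1) = h j (b + 1) →
        a = b ∧ i = j := by
      intro i j a b ha hb he
      rcases le_total a b with hab | hab
      · exact hinj i j a b ha hb hab he
      · obtain ⟨h1, h2⟩ := hinj j i b a hb ha hab he.symm
        exact ⟨h1.symm, h2.symm⟩
    have hmem : ∀ w, w ∈ ((List.finRange n).map fun i =>
        (List.range (k i)).map fun a => h i (a + 1)).flatten → w ≠ u ∧ w ≠ v := by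
      intro w hw
      simp only [List.mem_flatten, List.mem_map, List.mem_finRange, true_and,
        exists_exists_eq_and, List.mem_range] at hw
      obtain ⟨i, a, ha, rfl⟩ := hw
      exact ⟨(hinner i a ha).1, (hinner i a ha).2.1⟩
    rw [List.nodup_cons, List.nodup_cons, List.mem_cons, not_or]
    refine ⟨⟨huv, fun hu => (hmem u hu).1 rfl⟩, fun hv => (hmem v hv).2 rfl, ?_⟩
    rw [List.nodup_flatten]
    constructor
    · intro l hl'
      obtain ⟨i, -, rfl⟩ := List.mem_map.1 hl'
      refine List.Nodup.map_on ?_ List.nodup_range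
      intro a ha b hb hab
      exact (hinj' i i a b (List.mem_range.1 ha) (List.mem_range.1 hb) hab).1
    · rw [List.pairwise_map]
      refine (List.nodup_finRange n).imp ?_
      intro i j hij w hw1 hw2
      obtain ⟨a, ha, rfl⟩ := List.mem_map.1 hw1
      obtain ⟨b, hb, hab⟩ := List.mem_map.1 hw2
      exact hij (hinj' i j a b (List.mem_range.1 ha) (List.mem_range.1 hb) hab.symm).2

/-! ### Merging and inserting in tournaments -/

theorem IsTournament.adj_of_not {G : Digraph V} (h : G.IsTournament) {a b : V} (hab : a ≠ b)
    (hn : ¬ G.Adj a b) : G.Adj b a :=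
  (h.2 a b hab).or.resolve_left hn

theorem IsTournament.asymm {G : Digraph V} (h : G.IsTournament) {a b : V} (hab : G.Adj a b) :
    ¬ G.Adj b a := by
  intro hba
  rcases eq_or_ne a b with rfl | hne
  · exact h.1 _ hab
  · rcases h.2 a b hne with h | h
    · exact h.2 hba
    · exact h.2 hab

theorem isChain_cons_append_singleton {G : Digraph V} {u v : V} {p : List V} (hp : p ≠ []) :
    (u :: (p ++ [v])).IsChain G.Adj ↔
      (∀ x ∈ p.head?, G.Adj u x) ∧ p.IsChain G.Adj ∧ ∀ x ∈ p.getLast?, G.Adj x v := by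
  rw [List.isChain_cons, List.isChain_append, List.head?_append_of_ne_nil _ hp]
  simp

/-- Two disjoint paths with common ends can be merged into one. -/
theorem IsTournament.exists_merge {G : Digraph V} (h : G.IsTournament) {v : V} :
    ∀ (p q : List V) (u : V), (u :: (p ++ [v])).IsChain G.Adj → (u :: (q ++ [v])).IsChain G.Adj →
      p.Disjoint q → ∃ l, l.Perm (p ++ q) ∧ (u :: (l ++ [v])).IsChain G.Adj
  | [], q, _, _, hq, _ => ⟨q, List.Perm.refl _, hq⟩
  | p, [], _, hp, _, _ => ⟨p, by simp, hp⟩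
  | a :: p, b :: q, u, hp, hq, hd => by
    have hp' := hp
    have hq' := hq
    rw [List.cons_append, List.isChain_cons_cons] at hp' hq'
    -- As in merge sort, whichever of `a`, `b` dominates the other goes first and becomes the common
    -- start of the remaining two paths.
    by_cases hab : G.Adj a b
    · obtain ⟨l, hl, hc⟩ := h.exists_merge p (b :: q) a hp'.2
        (List.isChain_cons_cons.2 ⟨hab, hq'.2⟩) (List.disjoint_of_disjoint_cons_left hd)
      exact ⟨a :: l, hl.cons a, List.isChain_cons_cons.2 ⟨hp'.1, hc⟩⟩
    · have hba := h.adj_of_not (by rintro rfl; exact hd List.mem_cons_self List.mem_cons_self) hab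
      obtain ⟨l, hl, hc⟩ := h.exists_merge (a :: p) q b
        (List.isChain_cons_cons.2 ⟨hba, hp'.2⟩) hq'.2 (List.disjoint_of_disjoint_cons_right hd)
      exact ⟨b :: l, (hl.cons b).trans List.perm_middle.symm,
        List.isChain_cons_cons.2 ⟨hq'.1, hc⟩⟩
termination_by p q => p.length + q.length

/-- A vertex outside a path can be inserted between two consecutive vertices, or else the
vertices dominating it form a final segment. -/
theorem IsTournament.exists_insert_or_pairwise {G : Digraph V} (h : G.IsTournament) {r : V} :
    ∀ l : List V, l.IsChain G.Adj → r ∉ l →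
      (∃ l₁ l₂, l = l₁ ++ l₂ ∧ l₁ ≠ [] ∧ l₂ ≠ [] ∧ (l₁ ++ r :: l₂).IsChain G.Adj) ∨
        l.Pairwise fun a b => G.Adj a r → G.Adj b r
  | [], _, _ => Or.inr List.Pairwise.nil
  | [a], _, _ => Or.inr (List.pairwise_singleton _ _)
  | a :: b :: l, hl, hr => by
    rw [List.isChain_cons_cons] at hl
    rw [List.mem_cons, not_or] at hr
    by_cases hab : G.Adj a r ∧ G.Adj r b
    · refine Or.inl ⟨[a], b :: l, rfl, by simp, by simp, ?_⟩
      simp only [List.cons_append, List.nil_append, List.isChain_cons_cons]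
      exact ⟨hab.1, hab.2, hl.2⟩
    rcases h.exists_insert_or_pairwise (b :: l) hl.2 hr.2 with ⟨l₁, l₂, e, h₁, h₂, hc⟩ | hw
    · refine Or.inl ⟨a :: l₁, l₂, by rw [e]; rfl, by simp, h₂, ?_⟩
      obtain ⟨c, l₁, rfl⟩ := List.exists_cons_of_ne_nil h₁
      obtain rfl : b = c := by simpa using congrArg List.head? e
      exact List.isChain_cons_cons.2 ⟨hl.1, hc⟩
    · refine Or.inr (List.pairwise_cons.2 ⟨fun x hx ha => ?_, hw⟩)
      have hbr : G.Adj b r := h.adj_of_not (by rintro rfl; simp at hr) fun hb => hab ⟨ha, hb⟩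
      rcases List.mem_cons.1 hx with rfl | hx
      · exact hbr
      · exact (List.pairwise_cons.1 hw).1 x hx hbr

/-! ### Hamiltonian paths with prescribed end sets -/

theorem exists_forall_le_of_bounded {α : Type*} (P : α → Prop) (m : α → ℕ) (B : ℕ)
    (hne : ∃ a, P a) (hB : ∀ a, P a → m a ≤ B) : ∃ a, P a ∧ ∀ b, P b → m b ≤ m a := by
  classical
  obtain ⟨a₀, ha₀⟩ := hne
  obtain ⟨a, ha, he⟩ := Nat.findGreatest_spec (P := fun n => ∃ a, P a ∧ m a = n) (hB a₀ ha₀)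
    ⟨a₀, ha₀, rfl⟩
  refine ⟨a, ha, fun b hb => ?_⟩
  rw [he]
  exact Nat.le_findGreatest (hB b hb) ⟨b, hb, rfl⟩

/-- A tournament on the vertex set `R` has a Hamiltonian path from `N` to `O` provided that
`N` and `O` cover `R`, every nonempty set without leaving arcs meets `O` and every nonempty set
without entering arcs meets `N`. -/
theorem IsTournament.exists_path_covering [Finite V] {G : Digraph V} (h : G.IsTournament)
    (R N O : Set V) (hne : R.Nonempty) (hNR : N ⊆ R) (hcov : R ⊆ N ∪ O)
    (hout : ∀ Z ⊆ R, Z.Nonempty → (∀ z ∈ Z, ∀ w ∈ R, w ∉ Z → ¬ G.Adj z w) → (Z ∩ O).Nonempty)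
    (hin : ∀ Z ⊆ R, Z.Nonempty → (∀ z ∈ Z, ∀ w ∈ R, w ∉ Z → ¬ G.Adj w z) → (Z ∩ N).Nonempty) :
    ∃ s : List V, s ≠ [] ∧ s.IsChain G.Adj ∧ s.Nodup ∧ (∀ w, w ∈ s ↔ w ∈ R) ∧
      (∀ x ∈ s.head?, x ∈ N) ∧ ∀ x ∈ s.getLast?, x ∈ O := by
  classical
  have := Fintype.ofFinite V
  let good : List V → Prop := fun s => s ≠ [] ∧ s.IsChain G.Adj ∧ s.Nodup ∧ (∀ w ∈ s, w ∈ R) ∧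
      (∀ x ∈ s.head?, x ∈ N) ∧ ∀ x ∈ s.getLast?, x ∈ O
  have hstart : ∃ s, good s := by
    by_cases hNO : (N ∩ O).Nonempty
    · obtain ⟨x, hxN, hxO⟩ := hNO
      exact ⟨[x], by simp, by simp, by simp, by simpa using hNR hxN, by simpa using hxN,
        by simpa using hxO⟩
    · have hN : N.Nonempty := by
        obtain ⟨x, -, hx⟩ := hin R subset_rfl hne fun z _ w hw hw' => absurd hw hw'
        exact ⟨x, hx⟩
      have : ∃ z ∈ N, ∃ w ∈ R, w ∉ N ∧ G.Adj z w := by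
        by_contra! hc
        exact hNO (hout N hNR hN fun z hz w hw hw' => hc z hz w hw hw')
      obtain ⟨z, hz, w, hw, hwN, hzw⟩ := this
      have hwO : w ∈ O := (hcov hw).resolve_left hwN
      have hzne : z ≠ w := fun e => hwN (e ▸ hz)
      exact ⟨[z, w], by simp, by simp [hzw], by simp [hzne], by
        simp [hNR hz, hw], by simpa using hz, by simpa using hwO⟩
  obtain ⟨s, ⟨hs0, hsc, hsn, hsR, hsN, hsO⟩, hmax⟩ := exists_forall_le_of_bounded good
    List.length (Fintype.card V) hstart fun s hs =>
      hs.2.2.1.length_le_card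
  have hhead : ∃ a ∈ s, a ∈ s.head? := ⟨s.head hs0, List.head_mem hs0, by simp [List.head?_eq_some_head hs0]⟩
  obtain ⟨a, has, ha⟩ := hhead
  have hlast : ∃ b ∈ s, b ∈ s.getLast? :=
    ⟨s.getLast hs0, List.getLast_mem hs0, by simp [List.getLast?_eq_some_getLast hs0]⟩
  obtain ⟨b, hbs, hb⟩ := hlast
  have hno : ∀ r ∈ R, r ∉ s → s.Pairwise fun a b => G.Adj a r → G.Adj b r := by
    intro r hr hrs
    refine (h.exists_insert_or_pairwise s hsc hrs).resolve_left ?_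
    rintro ⟨l₁, l₂, rfl, h₁, h₂, hc⟩
    have hp : (l₁ ++ r :: l₂).Perm (r :: (l₁ ++ l₂)) := List.perm_middle
    have := hmax (l₁ ++ r :: l₂) ⟨by simp, hc, hp.nodup_iff.2 (List.nodup_cons.2 ⟨hrs, hsn⟩),
      fun w hw => ?_, ?_, ?_⟩
    · simp at this
    · rcases List.mem_cons.1 (hp.mem_iff.1 hw) with rfl | hw
      exacts [hr, hsR w hw]
    · rw [List.head?_append_of_ne_nil _ h₁] at hsN ⊢
      exact hsN
    · obtain ⟨c, l₂, rfl⟩ := List.exists_cons_of_ne_nil h₂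
      simpa [List.getLast?_append, List.getLast?_cons_cons] using hsO
  have hfst : ∀ r ∈ R, r ∉ s → G.Adj a r → ∀ x ∈ s, G.Adj x r := by
    intro r hr hrs har x hx
    have hpw := hno r hr hrs
    obtain ⟨s', rfl⟩ := List.head?_eq_some_iff.1 ha
    rcases List.mem_cons.1 hx with rfl | hx
    exacts [har, (List.pairwise_cons.1 hpw).1 x hx har]
  have hlst : ∀ r ∈ R, r ∉ s → G.Adj r b → ∀ x ∈ s, G.Adj r x := by
    intro r hr hrs hrb x hx
    have hpw := hno r hr hrs
    refine h.adj_of_not (fun e => hrs (e ▸ hx)) fun hxr => h.asymm hrb ?_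
    obtain ⟨s', rfl⟩ := List.getLast?_eq_some_iff.1 hb
    rcases List.mem_append.1 hx with hx | hx
    · exact (List.pairwise_append.1 hpw).2.2 x hx b (by simp) hxr
    · rwa [List.mem_singleton.1 hx] at hxr
  have hpre : ∀ r ∈ R, r ∉ s → r ∈ N → G.Adj a r := by
    intro r hr hrs hrN
    refine h.adj_of_not (fun e => hrs (e ▸ has)) fun hra => ?_
    have := hmax (r :: s) ⟨by simp, ?_, List.nodup_cons.2 ⟨hrs, hsn⟩, ?_, by simpa using hrN, ?_⟩
    · simp at this
    · refine List.isChain_cons.2 ⟨fun y hy => ?_, hsc⟩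
      rwa [← Option.mem_unique ha hy]
    · intro w hw
      rcases List.mem_cons.1 hw with rfl | hw
      exacts [hr, hsR w hw]
    · obtain ⟨c, s', rfl⟩ := List.exists_cons_of_ne_nil hs0
      simpa only [List.getLast?_cons_cons] using hsO
  have happ : ∀ t : List V, t ≠ [] → t.IsChain G.Adj → t.Nodup → (∀ x ∈ t, x ∈ R ∧ x ∉ s) →
      (∀ x ∈ t.getLast?, x ∈ O) → ∀ x ∈ t.head?, ¬ G.Adj b x := by
    intro t ht htc htn htR htO x hx hbx
    have := hmax (s ++ t) ⟨by simp [hs0], ?_, ?_, ?_, ?_, ?_⟩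
    · have hlen := List.length_pos_of_ne_nil ht
      rw [List.length_append] at this
      omega
    · refine List.isChain_append.2 ⟨hsc, htc, fun y hy z hz => ?_⟩
      rwa [← Option.mem_unique hb hy, ← Option.mem_unique hx hz]
    · exact List.nodup_append'.2 ⟨hsn, htn, fun y hy hy' => (htR y hy').2 hy⟩
    · intro w hw
      rcases List.mem_append.1 hw with hw | hw
      exacts [hsR w hw, (htR w hw).1]
    · rwa [List.head?_append_of_ne_nil _ hs0]
    · rwa [List.getLast?_append_of_ne_nil _ ht]
  have hpost : ∀ r ∈ R, r ∉ s → r ∈ O → G.Adj r b := by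
    intro r hr hrs hrO
    refine h.adj_of_not (fun e => hrs (e ▸ hbs)) ?_
    exact happ [r] (by simp) (by simp) (by simp) (by simpa using ⟨hr, hrs⟩) (by simpa using hrO) r
      (by simp)
  refine ⟨s, hs0, hsc, hsn, fun w => ⟨hsR w, fun hw => ?_⟩, hsN, hsO⟩
  by_contra hws
  -- The missed vertices of `N` are dominated by all of `s`, and an arc from one to a missed vertex
  -- of `O` outside `N` would extend `s` by two vertices. So no arc leaves this set, and it meets
  -- `O` in a vertex that could be appended to `s`.
  have hA : ∀ r ∈ R, r ∉ s → r ∉ N := by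
    intro r hr hrs hrN
    obtain ⟨x, ⟨hxR, hxs, hxN⟩, hxO⟩ := hout {x | x ∈ R ∧ x ∉ s ∧ x ∈ N} (fun x hx => hx.1)
      ⟨r, hr, hrs, hrN⟩ (by
        rintro z ⟨hzR, hzs, hzN⟩ y hy hyZ hzy
        have hz := hfst z hzR hzs (hpre z hzR hzs hzN)
        by_cases hys : y ∈ s
        · exact h.asymm hzy (hz y hys)
        · have hyO : y ∈ O := (hcov hy).resolve_left fun hyN => hyZ ⟨hy, hys, hyN⟩
          have hzne : z ≠ y := by rintro rfl; exact h.1 _ hzy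
          exact happ [z, y] (by simp) (by simp [hzy]) (by simp [hzne])
            (by simpa using ⟨⟨hzR, hzs⟩, hy, hys⟩) (by simpa using hyO) z (by simp) (hz b hbs))
    exact h.asymm (hpost x hxR hxs hxO) (hfst x hxR hxs (hpre x hxR hxs hxN) b hbs)
  -- All missed vertices now lie in `O`, so they dominate `b` and with it all of `s`: no arc enters
  -- their set.
  obtain ⟨x, ⟨hxR, hxs⟩, hxN⟩ := hin {x | x ∈ R ∧ x ∉ s} (fun x hx => hx.1) ⟨w, hw, hws⟩ (by
    rintro z ⟨hzR, hzs⟩ y hy hyZ hyz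
    have hys : y ∈ s := by by_contra hys; exact hyZ ⟨hy, hys⟩
    have hzO : z ∈ O := (hcov hzR).resolve_left (hA z hzR hzs)
    exact h.asymm hyz (hlst z hzR hzs (hpost z hzR hzs hzO) y hys))
  exact hA x hxR hxs hxN

/-! ### Rerouting path systems -/

/-- Replacing the paths in `A` by a single path through their vertices and new vertices `s`. -/
theorem IsPathSystem.replace {G : Digraph V} {u v : V} {L A L₁ : List (List V)} {l s : List V}
    (hL : G.IsPathSystem u v L) (hA : L.Perm (A ++ L₁)) (hl : l.Perm (s ++ A.flatten))
    (hc : (u :: (l ++ [v])).IsChain G.Adj) (hs : s.Nodup)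
    (hd : ∀ w ∈ s, w ∉ u :: v :: L.flatten) :
    G.IsPathSystem u v (l :: L₁) ∧ (l :: L₁).flatten.Perm (s ++ L.flatten) := by
  have hp : (l :: L₁).flatten.Perm (s ++ L.flatten) := by
    have h₁ := hA.flatten
    rw [List.flatten_append] at h₁
    rw [List.flatten_cons]
    refine (hl.append_right _).trans ?_
    rw [List.append_assoc]
    exact h₁.symm.append_left s
  refine ⟨⟨fun p hp => ?_, ?_⟩, hp⟩
  · rcases List.mem_cons.1 hp with rfl | hp
    · exact hc
    · exact hL.1 p (hA.mem_iff.2 (List.mem_append_right _ hp))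
  · have h₂ : (u :: v :: (s ++ L.flatten)).Perm (s ++ (u :: v :: L.flatten)) :=
      (List.perm_middle.symm.cons u).trans List.perm_middle.symm
    rw [((hp.cons v).cons u).nodup_iff, h₂.nodup_iff]
    exact List.nodup_append'.2 ⟨hs, hL.2, fun w hw hw' => hd w hw hw'⟩

theorem IsPathSystem.exists_length_eq {G : Digraph V} (h : G.IsTournament) {u v : V} {k : ℕ}
    (hk : 1 ≤ k) (m : ℕ) : ∀ L : List (List V), L.length = k + m → G.IsPathSystem u v L →
      ∃ L', L'.length = k ∧ G.IsPathSystem u v L' ∧ L'.flatten.Perm L.flatten := by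
  induction m with
  | zero => exact fun L hlen hL => ⟨L, hlen, hL, List.Perm.refl _⟩
  | succ m ih =>
    intro L hlen hL
    obtain ⟨p, L, rfl⟩ := List.exists_cons_of_length_pos (l := L) (by omega)
    rw [List.length_cons] at hlen
    obtain ⟨q, L, rfl⟩ := List.exists_cons_of_length_pos (l := L) (by omega)
    rw [List.length_cons] at hlen
    have hnd := hL.2.of_cons.of_cons
    rw [List.flatten_cons, List.flatten_cons, ← List.append_assoc] at hnd
    obtain ⟨l, hl, hc⟩ := h.exists_merge p q u (hL.1 p (by simp)) (hL.1 q (by simp))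
      (List.nodup_append'.1 (List.nodup_append'.1 hnd).1).2.2
    obtain ⟨hL', hp⟩ := hL.replace (A := [p, q]) (L₁ := L) (s := []) (List.Perm.refl _)
      (by simpa using hl) hc List.nodup_nil (by simp)
    obtain ⟨L', h₁, h₂, h₃⟩ := ih (l :: L) (by rw [List.length_cons]; omega) hL'
    exact ⟨L', h₁, h₂, h₃.trans (by simpa using hp)⟩

theorem IsTournament.exists_insert_or_pairwise_path {G : Digraph V} (h : G.IsTournament)
    {u v r : V} {p : List V} (hc : (u :: (p ++ [v])).IsChain G.Adj) (hr : r ∉ u :: (p ++ [v])) :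
    (∃ q : List V, q.Perm (r :: p) ∧ (u :: (q ++ [v])).IsChain G.Adj) ∨
      (u :: (p ++ [v])).Pairwise fun a b => G.Adj a r → G.Adj b r := by
  refine (h.exists_insert_or_pairwise _ hc hr).imp ?_ id
  rintro ⟨l₁, l₂, e, h₁, h₂, hq⟩
  obtain ⟨a, l₁, rfl⟩ := List.exists_cons_of_ne_nil h₁
  obtain ⟨l₂, b, rfl⟩ := (List.eq_nil_or_concat' l₂).resolve_left h₂
  rw [List.cons_append, List.cons.injEq, ← List.append_assoc] at e
  obtain ⟨rfl, e⟩ := e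
  obtain ⟨rfl, e⟩ := List.append_inj' e rfl
  obtain rfl : v = b := by simpa using e
  exact ⟨l₁ ++ r :: l₂, List.perm_middle, by simpa using hq⟩

/-- A discrete intermediate value argument; it finds the place to cut the Hamiltonian path of the
missed vertices. -/
theorem exists_split_of_head_of_not_getLast {α : Type*} (B : α → Prop) :
    ∀ s : List α, s ≠ [] → (∀ x ∈ s.head?, B x) → (∀ x ∈ s.getLast?, ¬ B x) →
      ∃ s₁ s₂ a b, s = s₁ ++ s₂ ∧ a ∈ s₁.getLast? ∧ b ∈ s₂.head? ∧ B a ∧ ¬ B b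
  | [], h, _, _ => absurd rfl h
  | [a], _, h₁, h₂ => absurd (h₁ a (by simp)) (h₂ a (by simp))
  | a :: b :: s, _, h₁, h₂ => by
    by_cases hb : B b
    · obtain ⟨s₁, s₂, x, y, e, hx, hy, hB⟩ := exists_split_of_head_of_not_getLast B (b :: s)
        (by simp) (by simpa using hb) (by simpa only [List.getLast?_cons_cons] using h₂)
      refine ⟨a :: s₁, s₂, x, y, by rw [e]; rfl, ?_, hy, hB⟩
      obtain ⟨c, s₁, rfl⟩ := List.exists_cons_of_ne_nil (l := s₁) (by rintro rfl; simp at hx)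
      rwa [List.getLast?_cons_cons]
    · exact ⟨[a], b :: s, a, b, rfl, by simp, by simp, h₁ a (by simp), hb⟩

/-- Up to two merges, a family of internally disjoint paths of maximal coverage can be turned
into one covering all vertices. -/
theorem IsTournament.exists_spanning_isPathSystem [Fintype V] {G : Digraph V}
    (h : G.IsTournament) {u v : V} (huv : u ≠ v) (hadj : ¬ G.Adj u v) {n : ℕ} (hn : 3 ≤ n)
    (hs : ∀ S : Finset V, S.card < n → (G.deleteVertices S).IsStrong) :
    ∃ L : List (List V), n ≤ L.length + 2 ∧ G.IsPathSystem u v L ∧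
      ∀ w, w ∈ u :: v :: L.flatten := by
  classical
  obtain ⟨L, ⟨hlen, hL⟩, hmax⟩ := exists_forall_le_of_bounded
    (fun L : List (List V) => L.length = n ∧ G.IsPathSystem u v L) (fun L => L.flatten.length)
    (Fintype.card V) (exists_isPathSystem G huv hadj hs)
    fun L hL => hL.2.2.of_cons.of_cons.length_le_card
  by_cases hR : ∀ w, w ∈ u :: v :: L.flatten
  · exact ⟨L, by omega, hL, hR⟩
  have hne : ∀ p ∈ L, p ≠ [] := by
    rintro p hp rfl
    exact hadj (by simpa using hL.1 _ hp)
  have hLne : ∃ p, p ∈ L := List.exists_mem_of_length_pos (by omega)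
  set R : Set V := {w | w ∉ u :: v :: L.flatten} with hRdef
  have hRne : R.Nonempty := not_forall.1 hR
  have hRu : ∀ r ∈ R, r ≠ u := by rintro r hr rfl; exact hr (by simp)
  have hRv : ∀ r ∈ R, r ≠ v := by rintro r hr rfl; exact hr (by simp)
  have hRp : ∀ r ∈ R, ∀ p ∈ L, r ∉ p := fun r hr p hp hrp =>
    hr (List.mem_cons_of_mem _ (List.mem_cons_of_mem _ (List.mem_flatten.2 ⟨p, hp, hrp⟩)))
  have hnR : ∀ w, w ∉ R → w = u ∨ w = v ∨ ∃ p ∈ L, w ∈ p := by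
    intro w hw
    simpa using not_not.1 hw
  have hpw : ∀ r ∈ R, ∀ p ∈ L, (u :: (p ++ [v])).Pairwise fun a b => G.Adj a r → G.Adj b r := by
    intro r hr p hp
    refine (h.exists_insert_or_pairwise_path (hL.1 p hp)
      (by simpa using ⟨hRu r hr, hRp r hr p hp, hRv r hr⟩)).resolve_left ?_
    rintro ⟨q, hq, hc⟩
    have hperm := List.perm_cons_erase hp
    obtain ⟨hL', hp'⟩ := hL.replace (A := [p]) (s := [r]) hperm (by simpa using hq) hc (by simp)
      (by intro w hw; rwa [List.mem_singleton.1 hw])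
    have h₁ := hmax _ ⟨by rw [← hlen, hperm.length_eq]; rfl, hL'⟩
    have h₂ := hp'.length_eq
    rw [h₂] at h₁
    simp at h₁
  have hentry : ∀ r ∈ R, ∀ p ∈ L, ∀ w ∈ u :: p, G.Adj w r → ∀ x ∈ p.getLast?, G.Adj x r := by
    intro r hr p hp w hw hwr x hx
    have hpr := hpw r hr p hp
    obtain ⟨p, rfl⟩ := List.getLast?_eq_some_iff.1 hx
    rw [← List.cons_append, List.pairwise_append, ← List.cons_append, List.pairwise_append] at hpr
    rw [← List.cons_append, List.mem_append, List.mem_singleton] at hw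
    rcases hw with hw | rfl
    · exact hpr.1.2.2 w hw x (by simp) hwr
    · exact hwr
  have hexit : ∀ r ∈ R, ∀ p ∈ L, ∀ w ∈ p ++ [v], G.Adj r w → ∀ x ∈ p.head?, G.Adj r x := by
    intro r hr p hp w hw hrw x hx
    have hpr := hpw r hr p hp
    have hrp := hRp r hr p hp
    obtain ⟨p, rfl⟩ := List.head?_eq_some_iff.1 hx
    refine h.adj_of_not (by rintro rfl; simp at hrp) fun hxr => h.asymm hrw ?_
    rw [List.cons_append, List.mem_cons] at hw
    rcases hw with rfl | hw
    · exact hxr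
    · exact (List.pairwise_cons.1 (List.pairwise_cons.1 hpr).2).1 w hw hxr
  have hor : ∀ r ∈ R, ∀ p ∈ L, ¬ (∀ x ∈ p.head?, G.Adj r x) → ∀ x ∈ p.getLast?, G.Adj x r := by
    intro r hr p hp hnx
    push Not at hnx
    obtain ⟨x, hx, hrx⟩ := hnx
    have hxp : x ∈ p := List.mem_of_mem_head? hx
    exact hentry r hr p hp x (List.mem_cons_of_mem _ hxp)
      (h.adj_of_not (by rintro rfl; exact hRp r hr p hp hxp) hrx)
  obtain ⟨s, hs0, hsc, hsn, hsR, hsN, hsO⟩ := h.exists_path_covering R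
    {r | r ∈ R ∧ ∃ p ∈ L, ∀ x ∈ p.getLast?, G.Adj x r}
    {r | r ∈ R ∧ ∃ p ∈ L, ∀ x ∈ p.head?, G.Adj r x} hRne (fun r hr => hr.1)
    (by
      intro r hr
      obtain ⟨p, hp⟩ := hLne
      by_cases hx : ∀ x ∈ p.head?, G.Adj r x
      · exact Or.inr ⟨hr, p, hp, hx⟩
      · exact Or.inl ⟨hr, p, hp, hor r hr p hp hx⟩)
    (by
      rintro Z hZ ⟨z, hz⟩ hcl
      -- Deleting `u` rules out arcs back to `u`, which say nothing about the starts of the paths;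
      -- deleting `v` plays the dual role below.
      obtain ⟨z, hz, w, hw, -, hwu, hzw⟩ := (hs {u} (by simp; omega)).exists_adj_leaving Z
        (a := z) (b := v) (by simpa using hRu z (hZ hz)) (by simpa using huv.symm) hz
        (fun hv => hRv v (hZ hv) rfl)
      refine ⟨z, hz, hZ hz, ?_⟩
      rw [Finset.mem_singleton] at hwu
      rcases hnR w fun hwR => hcl z hz w hwR hw hzw with rfl | rfl | ⟨p, hp, hwp⟩
      · exact absurd rfl hwu
      · obtain ⟨p, hp⟩ := hLne
        exact ⟨p, hp, hexit z (hZ hz) p hp w (by simp) hzw⟩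
      · exact ⟨p, hp, hexit z (hZ hz) p hp w (by simp [hwp]) hzw⟩)
    (by
      rintro Z hZ ⟨z, hz⟩ hcl
      obtain ⟨w, hw, z, hz, hwv, -, hwz⟩ := (hs {v} (by simp; omega)).exists_adj_leaving Zᶜ
        (a := u) (b := z) (by simpa using huv) (by simpa using hRv z (hZ hz))
        (fun hu => hRu u (hZ hu) rfl) (fun hz' => hz' hz)
      rw [Set.notMem_compl_iff] at hz
      refine ⟨z, hz, hZ hz, ?_⟩
      rw [Finset.mem_singleton] at hwv
      rcases hnR w fun hwR => hcl z hz w hwR hw hwz with rfl | rfl | ⟨p, hp, hwp⟩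
      · obtain ⟨p, hp⟩ := hLne
        exact ⟨p, hp, hentry z (hZ hz) p hp w (by simp) hwz⟩
      · exact absurd rfl hwv
      · exact ⟨p, hp, hentry z (hZ hz) p hp w (by simp [hwp]) hwz⟩)
  have hpath : ∀ p ∈ L, (∀ x ∈ p.head?, G.Adj u x) ∧ p.IsChain G.Adj ∧
      ∀ x ∈ p.getLast?, G.Adj x v := fun p hp =>
    (isChain_cons_append_singleton (hne p hp)).1 (hL.1 p hp)
  -- Turning at most three paths into one costs at most two paths.
  have hfin : ∀ (A L₁ : List (List V)) (l : List V), L.Perm (A ++ L₁) → A.length ≤ 3 →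
      l.Perm (s ++ A.flatten) → (u :: (l ++ [v])).IsChain G.Adj →
      ∃ L : List (List V), n ≤ L.length + 2 ∧ G.IsPathSystem u v L ∧
        ∀ w, w ∈ u :: v :: L.flatten := by
    intro A L₁ l hA hA3 hl hc
    obtain ⟨hL', hp'⟩ := hL.replace hA hl hc hsn fun w hw => (hsR w).1 hw
    refine ⟨_, ?_, hL', fun w => ?_⟩
    · have := hA.length_eq
      rw [List.length_append] at this
      rw [List.length_cons]
      omega
    · rw [((hp'.cons v).cons u).mem_iff]
      have := hsR w
      simp only [hRdef, Set.mem_ofPred_eq] at this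
      simp only [List.mem_cons, List.mem_append] at this ⊢
      tauto
  obtain ⟨a, ha⟩ : ∃ a, a ∈ s.head? := ⟨_, List.head?_eq_some_head hs0⟩
  obtain ⟨b, hb⟩ : ∃ b, b ∈ s.getLast? := ⟨_, List.getLast?_eq_some_getLast hs0⟩
  obtain ⟨haR, p, hp, hap⟩ := hsN a ha
  obtain ⟨hbR, q, hq, hbq⟩ := hsO b hb
  have hjoin : ∀ (p q : List V), p ∈ L → q ∈ L → (∀ x ∈ p.getLast?, G.Adj x a) →
      (∀ x ∈ q.head?, G.Adj b x) → (u :: ((p ++ (s ++ q)) ++ [v])).IsChain G.Adj := by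
    intro p q hp hq hap hbq
    have hp0 := hne p hp
    have hq0 := hne q hq
    rw [isChain_cons_append_singleton (by simp [hp0]), List.isChain_append, List.isChain_append,
      List.head?_append_of_ne_nil _ hp0, List.getLast?_append_of_ne_nil _ (by simp [hq0]),
      List.getLast?_append_of_ne_nil _ hq0, List.head?_append_of_ne_nil _ hs0]
    refine ⟨(hpath p hp).1, ⟨(hpath p hp).2.1, ⟨hsc, (hpath q hq).2.1, ?_⟩, ?_⟩,
      (hpath q hq).2.2⟩
    · intro x hx y hy
      rw [Option.mem_unique hx hb]
      exact hbq y hy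
    · intro x hx y hy
      rw [Option.mem_unique hy ha]
      exact hap x hx
  have htwo : ∀ (p q : List V) (L₁ : List (List V)), L.Perm (p :: q :: L₁) →
      (∀ x ∈ p.getLast?, G.Adj x a) → (∀ x ∈ q.head?, G.Adj b x) →
      ∃ L : List (List V), n ≤ L.length + 2 ∧ G.IsPathSystem u v L ∧
        ∀ w, w ∈ u :: v :: L.flatten := by
    intro p q L₁ hperm hap hbq
    refine hfin [p, q] L₁ (p ++ (s ++ q)) hperm (by simp) ?_
      (hjoin p q (hperm.mem_iff.2 (by simp)) (hperm.mem_iff.2 (by simp)) hap hbq)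
    simpa using List.perm_append_comm_assoc p s q
  by_cases hpq : p = q
  swap
  · have h₁ := List.perm_cons_erase hp
    have hq' : q ∈ L.erase p := (List.mem_erase_of_ne (Ne.symm hpq)).2 hq
    exact htwo p q _ (h₁.trans ((List.perm_cons_erase hq').cons p)) hap hbq
  subst hpq
  have h₁ := List.perm_cons_erase hp
  have hlen₁ := h₁.length_eq
  generalize L.erase p = L₁ at h₁ hlen₁
  rw [List.length_cons] at hlen₁
  obtain ⟨q, L₁, rfl⟩ := List.exists_cons_of_length_pos (l := L₁) (by omega)
  rw [List.length_cons] at hlen₁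
  obtain ⟨q', L₁, rfl⟩ := List.exists_cons_of_length_pos (l := L₁) (by omega)
  have h₂ : L.Perm (p :: q' :: q :: L₁) := h₁.trans ((List.Perm.swap _ _ _).cons p)
  have hqL : q ∈ L := h₁.mem_iff.2 (by simp)
  have hqL' : q' ∈ L := h₁.mem_iff.2 (by simp)
  by_cases hbq₁ : ∀ x ∈ q.head?, G.Adj b x
  · exact htwo p q _ h₁ hap hbq₁
  by_cases hbq₂ : ∀ x ∈ q'.head?, G.Adj b x
  · exact htwo p q' _ h₂ hap hbq₂
  by_cases haq : ∀ x ∈ q.head?, G.Adj a x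
  swap
  · exact htwo q p _ (h₁.trans (List.Perm.swap _ _ _)) (hor a haR q hqL haq) hbq
  -- Only `p = q` is left: `a` dominates the start of `q`, and `b` that of neither spare path. Cut
  -- `s` where domination of a spare start stops.
  obtain ⟨s₁, s₂, c, d, e, hc, hd, hBc, hBd⟩ := exists_split_of_head_of_not_getLast
    (fun r => (∀ x ∈ q.head?, G.Adj r x) ∨ ∀ x ∈ q'.head?, G.Adj r x) s hs0
    (fun x hx => by rw [Option.mem_unique hx ha]; exact Or.inl haq)
    (fun x hx => by rw [Option.mem_unique hx hb]; exact not_or.2 ⟨hbq₁, hbq₂⟩)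
  have hs₁ : s₁ ≠ [] := by rintro rfl; simp at hc
  have hs₂ : s₂ ≠ [] := by rintro rfl; simp at hd
  have hdR : d ∈ R := (hsR d).1 (e ▸ List.mem_append_right _ (List.mem_of_mem_head? hd))
  rw [not_or] at hBd
  have hthree : ∀ q q' : List V, L.Perm (p :: q :: q' :: L₁) → (∀ x ∈ q.head?, G.Adj c x) →
      ¬ (∀ x ∈ q'.head?, G.Adj d x) → ∃ L : List (List V), n ≤ L.length + 2 ∧
        G.IsPathSystem u v L ∧ ∀ w, w ∈ u :: v :: L.flatten := by
    intro q q' hperm hcq hdq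
    have hqL : q ∈ L := hperm.mem_iff.2 (by simp)
    have hqL' : q' ∈ L := hperm.mem_iff.2 (by simp)
    have hp0 := hne p hp
    have hq0 := hne q hqL
    have hq0' := hne q' hqL'
    rw [e, List.head?_append_of_ne_nil _ hs₁] at ha
    rw [e, List.getLast?_append_of_ne_nil _ hs₂] at hb
    rw [e, List.isChain_append] at hsc
    -- The last vertex of `q'` dominates `d` by `hor`, and `b` leads into `p`, which leads to `a`;
    -- finally `c` leads into `q`. The arc from `c` to `d` is not used.
    refine hfin [p, q, q'] L₁ (q' ++ (s₂ ++ (p ++ (s₁ ++ q)))) hperm (by simp) ?_ ?_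
    · rw [e]
      simp only [List.flatten_cons, List.flatten_nil, List.append_nil]
      rw [List.perm_iff_count]
      intro x
      simp only [List.count_append]
      omega
    · rw [isChain_cons_append_singleton (by simp [hq0]), List.isChain_append, List.isChain_append,
        List.isChain_append, List.isChain_append, List.head?_append_of_ne_nil _ hq0',
        List.head?_append_of_ne_nil _ hs₂, List.head?_append_of_ne_nil _ hp0,
        List.head?_append_of_ne_nil _ hs₁, List.getLast?_append_of_ne_nil _ (by simp [hq0]),
        List.getLast?_append_of_ne_nil _ (by simp [hq0]),
        List.getLast?_append_of_ne_nil _ (by simp [hq0]), List.getLast?_append_of_ne_nil _ hq0]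
      refine ⟨(hpath q' hqL').1, ⟨(hpath q' hqL').2.1, ⟨hsc.2.1, ⟨(hpath p hp).2.1,
        ⟨hsc.1, (hpath q hqL).2.1, ?_⟩, ?_⟩, ?_⟩, ?_⟩, (hpath q hqL).2.2⟩
      · intro x hx y hy
        rw [Option.mem_unique hx hc]
        exact hcq y hy
      · intro x hx y hy
        rw [Option.mem_unique hy ha]
        exact hap x hx
      · intro x hx y hy
        rw [Option.mem_unique hx hb]
        exact hbq y hy
      · intro x hx y hy
        rw [Option.mem_unique hy hd]
        exact hor d hdR q' hqL' hdq x hx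
  rcases hBc with hBc | hBc
  · exact hthree q q' h₁ hBc hBd.2
  · exact hthree q' q h₂ hBc hBd.1

/-! ### From path systems to containers -/

theorem IsPathSystem.isSpanningContainerFromTo [DecidableEq V] {G : Digraph V} {u v : V}
    {L : List (List V)} (hL : G.IsPathSystem u v L) (hne : L ≠ []) (hempty : [] ∉ L)
    (hcov : ∀ w, w ∈ u :: v :: L.flatten) :
    G.IsSpanningContainerFromTo L.length u v (L.map fun p => u :: (p ++ [v])).toFinset := by
  have hnd := List.nodup_flatten.1 hL.2.of_cons.of_cons
  have hu : ∀ p ∈ L, u ∉ p ∧ v ∉ p := by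
    intro p hp
    have h₁ := hL.2
    simp only [List.nodup_cons, List.mem_cons, List.mem_flatten, not_or, not_exists, not_and] at h₁
    exact ⟨h₁.1.2 p hp, h₁.2.1 p hp⟩
  have huv : u ≠ v := by
    rintro rfl
    simpa using hL.2
  -- Disjointness alone would allow the empty interior to be repeated, which would lower the
  -- cardinality of the finset.
  have hLn : L.Nodup := by
    refine List.Pairwise.imp_of_mem ?_ hnd.2
    rintro p q hp - hpq rfl
    obtain ⟨x, p, rfl⟩ := List.exists_cons_of_ne_nil (l := p) (by rintro rfl; exact hempty hp)
    exact hpq List.mem_cons_self List.mem_cons_self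
  refine ⟨?_, ?_, ?_, ?_⟩
  · rw [List.toFinset_card_of_nodup, List.length_map]
    refine hLn.map fun p q hpq => ?_
    simpa using hpq
  · intro p hp
    rw [List.mem_toFinset, List.mem_map] at hp
    obtain ⟨p, hp, rfl⟩ := hp
    refine ⟨hL.1 p hp, ?_, by simp, ?_⟩
    · rw [List.nodup_cons, List.nodup_append']
      simp [huv, hnd.1 p hp, hu p hp]
    · rw [← List.cons_append, List.getLast?_append_of_ne_nil _ (by simp)]
      simp
  · intro p hp q hq hpq w hwp hwq
    rw [List.mem_toFinset, List.mem_map] at hp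
    obtain ⟨p, hp, rfl⟩ := hp
    rw [List.mem_toFinset, List.mem_map] at hq
    obtain ⟨q, hq, rfl⟩ := hq
    have hne : p ≠ q := by rintro rfl; exact hpq rfl
    have : Std.Symm (List.Disjoint (α := V)) := ⟨fun _ _ h => h.symm⟩
    have hdisj : p.Disjoint q := hnd.2.forall hp hq hne
    simp only [List.mem_cons, List.mem_append, List.not_mem_nil, or_false] at hwp hwq
    have := @hdisj w
    tauto
  · intro w
    have := hcov w
    simp only [List.mem_cons, List.mem_flatten] at this
    simp only [List.mem_toFinset, List.mem_map, exists_exists_and_eq_and, List.mem_cons,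
      List.mem_append]
    obtain ⟨p, hp⟩ := List.exists_mem_of_ne_nil L hne
    rcases this with rfl | rfl | ⟨p, hp, hw⟩
    · exact ⟨p, hp, by simp⟩
    · exact ⟨p, hp, by simp⟩
    · exact ⟨p, hp, by simp [hw]⟩

theorem IsTournament.exists_isSpanningContainerFromTo [Fintype V] {G : Digraph V}
    (h : G.IsTournament) {u v : V} (huv : u ≠ v) (hadj : ¬ G.Adj u v) {k n : ℕ} (hk : 1 ≤ k)
    (hn : 3 ≤ n) (hkn : k + 2 ≤ n)
    (hs : ∀ S : Finset V, S.card < n → (G.deleteVertices S).IsStrong) :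
    ∃ C, G.IsSpanningContainerFromTo k u v C := by
  classical
  obtain ⟨L, hlen, hL, hcov⟩ := h.exists_spanning_isPathSystem huv hadj hn hs
  obtain ⟨L', rfl, hL', hp⟩ := IsPathSystem.exists_length_eq h hk (L.length - k) L (by omega) hL
  refine ⟨_, hL'.isSpanningContainerFromTo (List.ne_nil_of_length_pos hk) ?_ fun w => ?_⟩
  · intro hmem
    exact hadj (by simpa using hL'.1 _ hmem)
  · rw [((hp.cons v).cons u).mem_iff]
    exact hcov w

end Digraph

theorem mainTheorem3 {V : Type*} [Fintype V] (T : Digraph V) (hT : T.IsTournament)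
    (k : ℕ) (hk : 2 ≤ k) (hstrong : T.IsKStrong (2 * k)) :
    T.IsStarStronglyConnected k := by
  intro u v huv
  -- The paths run against the arc joining `u` and `v`. The bound `k + 2 ≤ 2 * k` is where `2 ≤ k`
  -- enters.
  by_cases hadj : T.Adj u v
  · obtain ⟨C, hC⟩ := hT.exists_isSpanningContainerFromTo huv.symm (hT.asymm hadj) (k := k)
      (n := 2 * k) (by omega) (by omega) (by omega) hstrong.2
    exact ⟨C, Or.inr hC⟩
  · obtain ⟨C, hC⟩ := hT.exists_isSpanningContainerFromTo huv hadj (k := k)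
      (n := 2 * k) (by omega) (by omega) (by omega) hstrong.2
    exact ⟨C, Or.inl hC⟩
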